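/- Let $\mathcal X$ be a measurable space and let $k,m\ge 1$ and $d\ge 0$ be integers with $m\ge d$. Let $\mathcal D_T$ (target) and $\mathcal D_{S_1},\dots,\mathcal D_{S_k}$ (sources) be probability distributions on $\mathcal X$ with measurable labeling functions $f_T,f_{S_1},\dots,f_{S_k}:\mathcal X\to[0,1]$. Let $\mathcal H$ be a class of measurable functions $h:\mathcal X\to\{0,1\}$ of VC dimension $d$. As usual for uncountable classes, assume that for all $n$, all $b\in\{0,1\}^n$ and all $i$, the set $\{(x_1,\dots,x_n)\in\mathcal X^n : \exists h\in\mathcal H\ \forall j\ h(x_j)=b_j\}$ is measurable up to a $\mathcal D_{S_i}^{\,n}$-null set (automatic for countable $\mathcal H$). Put $\varepsilon_T(h)=\mathbb E_{x\sim\mathcal D_T}|h(x)-f_T(x)|$, $\varepsilon_{S_i}(h)=\mathbb E_{x\sim\mathcal D_{S_i}}|h(x)-f_{S_i}(x)|$ and $$\lambda=\inf_{h\in\mathcal H}\Big(\varepsilon_T(h)+\max_{i\in[k]}\varepsilon_{S_i}(h)\Big).$$ Let $\mathcal H\Delta\mathcal H=\{h\oplus h' : h,h'\in\mathcal H\}$,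 where $\oplus$ is pointwise xor, and for distributions $\mu,\nu_1,\dots,\nu_k$ put $$d_{\mathcal H\Delta\mathcal H}(\mu;\{\nu_i\}_{i=1}^k)=2\max_{i\in[k]}\ \sup_{g\in\mathcal H\Delta\mathcal H}\big|\mu(g^{-1}(1))-\nu_i(g^{-1}(1))\big|.$$ Draw $m$ i.i.d. points from each of $\mathcal D_T,\mathcal D_{S_1},\dots,\mathcal D_{S_k}$, all samples being independent. Let $\widehat{\mathcal D}_T,\widehat{\mathcal D}_{S_i}$ be the empirical distributions and let $\widehat\varepsilon_{S_i}(h)$ be the average of $|h-f_{S_i}|$ over the sample from $\mathcal D_{S_i}$. Then there is a universal constant $C>0$ (independent of all the data above and of $\delta$) such that for every $0<\delta<1$, with probability at least $1-\delta$ over the choice of samples, simultaneously for all $h\in\mathcal H$, $$\varepsilon_T(h)\le \max_{i\in[k]}\widehat\varepsilon_{S_i}(h)+\sqrt{\tfrac1{2m}\Big(\log\tfrac{4k}{\delta}+d\log\tfrac{me}{d}\Big)}+\tfrac12 d_{\mathcal H\Delta\mathcal H}\big(\widehat{\mathcal D}_T;\{\widehat{\mathcal D}_{S_i}\}_{i=1}^k\big)+\sqrt{\tfrac2m\Big(\log\tfrac{8k}{\delta}+2d\log\tfrac{me}{2d}\Big)}+\lambda$$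 and $$\varepsilon_T(h)\le \max_{i\in[k]}\widehat\varepsilon_{S_i}(h)+\tfrac12 d_{\mathcal H\Delta\mathcal H}\big(\widehat{\mathcal D}_T;\{\widehat{\mathcal D}_{S_i}\}_{i=1}^k\big)+\lambda+C\sqrt{\tfrac1m\Big(\log\tfrac k\delta+d\log\tfrac{me}{d}\Big)},$$ where $d\log\frac{me}{d}$ and $2d\log\frac{me}{2d}$ are read as $0$ when $d=0$. -/

import Mathlib

open MeasureTheory Real

noncomputable section

namespace MSDA

/-- The value in `{0, 1} ⊆ ℝ` of a Boolean label. -/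
def bit (b : Bool) : ℝ := if b then 1 else 0

/-- The risk `E_{x ∼ μ} |h x - f x|` of a binary hypothesis `h` with respect to the
labeling function `f` under the distribution `μ`. -/
def risk {X : Type*} [MeasurableSpace X] (μ : Measure X) (f : X → ℝ) (h : X → Bool) : ℝ :=
  ∫ x, |bit (h x) - f x| ∂μ

/-- The empirical risk of `h` on the sample `x` of size `m`, labeled by `f`. -/
def empRisk {X : Type*} {m : ℕ} (x : Fin m → X) (f : X → ℝ) (h : X → Bool) : ℝ :=
  (∑ j, |bit (h (x j)) - f (x j)|) / m

/-- The empirical distribution of the sample `x` of size `m`: mass `1 / m` at every sample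
point (counted with multiplicity). -/
def empMeasure {X : Type*} [MeasurableSpace X] {m : ℕ} (x : Fin m → X) : Measure X :=
  (m : ENNReal)⁻¹ • ∑ j, Measure.dirac (x j)

/-- The collection of the supports `h⁻¹(1)` of the hypotheses in `H`. -/
def supports {X : Type*} (H : Set (X → Bool)) : Set (Set X) :=
  {A | ∃ h ∈ H, A = {x | h x = true}}

/-- The symmetric difference class `H Δ H` of all `h ⊕ h'` with `h, h' ∈ H`. -/
def symmDiffClass {X : Type*} (H : Set (X → Bool)) : Set (X → Bool) :=
  {g | ∃ h ∈ H, ∃ h' ∈ H, g = fun x => xor (h x) (h' x)}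

/-- The divergence `2 sup_A |μ(A) - ν(A)|` over the supports `A` of hypotheses in `H`. -/
def hDiv {X : Type*} [MeasurableSpace X] (H : Set (X → Bool)) (μ ν : Measure X) : ℝ :=
  2 * ⨆ A : supports H, |μ.real A - ν.real A|

/-- The divergence between a distribution and a finite family of distributions: the maximum
of the pairwise divergences. -/
def hDivMulti {X : Type*} [MeasurableSpace X] {k : ℕ} (H : Set (X → Bool))
    (μ : Measure X) (ν : Fin k → Measure X) : ℝ :=
  ⨆ i, hDiv H μ (ν i)

/-- The optimal combined risk `inf_{h ∈ H} (ε_T(h) + max_i ε_{S_i}(h))`. -/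
def optRisk {X : Type*} [MeasurableSpace X] {k : ℕ} (H : Set (X → Bool))
    (DT : Measure X) (fT : X → ℝ) (DS : Fin k → Measure X) (fS : Fin k → X → ℝ) : ℝ :=
  ⨅ h : H, (risk DT fT h + ⨆ i, risk (DS i) (fS i) h)

/-- `H` realizes all the `2 ^ |S|` labelings of the finite set `S`. -/
def Shatters {X : Type*} (H : Set (X → Bool)) (S : Finset X) : Prop :=
  ∀ B ⊆ S, ∃ h ∈ H, ∀ x ∈ S, (h x = true ↔ x ∈ B)

/-- The VC dimension of `H` is (finite and) equal to `d`: the largest size of a finite set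
shattered by `H` is `d`. -/
def HasVCDim {X : Type*} (H : Set (X → Bool)) (d : ℕ) : Prop :=
  IsGreatest {n : ℕ | ∃ S : Finset X, S.card = n ∧ Shatters H S} d

/-- The measurability convention of empirical process theory for a (possibly uncountable)
binary class: for every labeling pattern `b` of length `n`, the event that some hypothesis
of `H` realizes `b` on an i.i.d. sample of size `n` from `μ` is measurable up to a null set. -/
def SampleMeasurable {X : Type*} [MeasurableSpace X] (H : Set (X → Bool)) (μ : Measure X) :
    Prop :=
  ∀ (n : ℕ) (b : Fin n → Bool),
    NullMeasurableSet {x : Fin n → X | ∃ h ∈ H, ∀ j, h (x j) = b j} (Measure.pi fun _ => μ)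

/-- The joint law of independent samples: `m` i.i.d. points from the target distribution and
`m` i.i.d. points from each of the `k` source distributions. -/
def sampleLaw {X : Type*} [MeasurableSpace X] {k : ℕ} (m : ℕ)
    (DT : Measure X) (DS : Fin k → Measure X) :
    Measure ((Fin m → X) × (Fin k → Fin m → X)) :=
  (Measure.pi fun _ : Fin m => DT).prod
    (Measure.pi fun i : Fin k => Measure.pi fun _ : Fin m => DS i)

end MSDA

end

namespace MSDA

/-! ### Exponential moments -/

/-! One source is enough. The maxima on the right-hand side dominate their values at any fixed
source `i`, so there is no union bound over sources. For the true distributions,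
`risk_le_add_hDiv_add_optRisk` bounds the target risk by the risk on source `i`, half the true
divergence and `optRisk`. Two quantities remain to be replaced by empirical ones, each at a cost of
`δ / 2` in probability.

The divergence needs no uniform convergence, because only an upper bound by its empirical version is
required. A set `A`, chosen before sampling, nearly attains the true supremum. A Hoeffding bound for
this one event (`exists_event_abs_sub_le`) gives the deviation `√(log (2 / δ) / m)`, and the
empirical supremum dominates its value at `A`.

The source risk does need uniformity over `H`. Adjoin `K` ghost points to each sample point and
exchange the sample point with a random member of its block. Conditionally on all points,
Hoeffding's lemma in each block bounds the exponential moment for every labeling, and Sauer–Shelah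
bounds the number of labelings. Jensen's inequality over the ghosts and Markov's inequality conclude
(`measure_exists_risk_gt_le`).

With `K` of size 7, the sum of the two deviations is strictly below the two square roots of the
first bound (`deviations_lt`). The slack pays for `A` not attaining the supremum. Dimension zero is
separate: `H` is then a single hypothesis. -/

theorem integral_exp_mul_sub_integral_le {X : Type*} [MeasurableSpace X] (μ : Measure X)
    [IsProbabilityMeasure μ] {g : X → ℝ} (hg : Measurable g)
    (hg01 : ∀ x, g x ∈ Set.Icc (0 : ℝ) 1) (t : ℝ) :
    ∫ x, exp (t * (g x - ∫ y, g y ∂μ)) ∂μ ≤ exp (t ^ 2 / 8) := by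
  have h := (ProbabilityTheory.hasSubgaussianMGF_of_mem_Icc (μ := μ) hg.aemeasurable
    (Filter.Eventually.of_forall hg01)).mgf_le t
  refine (show _ = _ from rfl).trans_le (h.trans (exp_le_exp.2 (le_of_eq ?_)))
  simp
  ring

/-- Hoeffding's lemma for the uniform distribution on `ι`. -/
theorem sum_exp_mul_le {ι : Type*} [Fintype ι] [Nonempty ι] {a : ι → ℝ}
    (ha : ∀ i, a i ∈ Set.Icc (0 : ℝ) 1) (t : ℝ) :
    ∑ i, exp (t * a i) ≤
      Fintype.card ι * exp (t * ((∑ i, a i) / Fintype.card ι) + t ^ 2 / 8) := by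
  let _ : MeasurableSpace ι := ⊤
  have hc : (0 : ℝ) < Fintype.card ι := by exact_mod_cast Fintype.card_pos
  let μ : Measure ι := (Fintype.card ι : ENNReal)⁻¹ • Measure.count
  have hμ : IsProbabilityMeasure μ := ⟨by
    simp only [μ, Measure.smul_apply, Measure.count_univ, smul_eq_mul]
    rw [ENat.card_eq_coe_fintype_card]
    simpa using ENNReal.inv_mul_cancel (by simp) (by simp)⟩
  have hint : ∀ g : ι → ℝ, ∫ i, g i ∂μ = (∑ i, g i) / Fintype.card ι := by
    intro g
    simp only [μ, integral_smul_measure, integral_count]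
    simp [div_eq_inv_mul]
  have h := integral_exp_mul_sub_integral_le μ (g := a) (measurable_of_countable _) ha t
  rw [hint, hint, div_le_iff₀ hc] at h
  have h2 := mul_le_mul_of_nonneg_left h (exp_pos (t * ((∑ i, a i) / Fintype.card ι))).le
  rw [Finset.mul_sum] at h2
  calc ∑ i, exp (t * a i) = _ := Finset.sum_congr rfl fun i _ => by
        rw [← exp_add]; ring_nf
    _ ≤ _ := h2
    _ = _ := by rw [exp_add]; ring

/-! ### Finite powers of a measure -/

theorem measurePreserving_comp_equiv {X ι κ : Type*} [MeasurableSpace X] [Fintype ι] [Fintype κ]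
    (μ : Measure X) [IsProbabilityMeasure μ] (e : ι ≃ κ) :
    MeasurePreserving (fun x : κ → X => x ∘ e) (Measure.pi fun _ => μ)
      (Measure.pi fun _ => μ) := by
  have h := measurePreserving_piCongrLeft (fun _ : ι => μ) e.symm
  convert h using 1
  ext x i
  have := Equiv.piCongrLeft_apply_apply (fun _ : ι => X) e.symm x (e i)
  simp only [Equiv.symm_apply_apply] at this
  simp [MeasurableEquiv.coe_piCongrLeft, this]

theorem measurePreserving_sumElim {X ι κ : Type*} [MeasurableSpace X] [Fintype ι] [Fintype κ]
    (μ : Measure X) [IsProbabilityMeasure μ] :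
    MeasurePreserving (fun p : (ι → X) × (κ → X) => Sum.elim p.1 p.2)
      ((Measure.pi fun _ => μ).prod (Measure.pi fun _ => μ)) (Measure.pi fun _ => μ) := by
  have h := measurePreserving_sumPiEquivProdPi_symm (fun _ : ι ⊕ κ => μ)
  convert h using 1
  ext p i
  cases i <;> rfl

theorem SampleMeasurable.nullMeasurableSet {X ι : Type*} [MeasurableSpace X] [Fintype ι]
    {H : Set (X → Bool)} {μ : Measure X} [IsProbabilityMeasure μ] (hH : SampleMeasurable H μ)
    (b : ι → Bool) :
    NullMeasurableSet {x : ι → X | ∃ h ∈ H, ∀ j, h (x j) = b j} (Measure.pi fun _ => μ) := by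
  let e := (Fintype.equivFin ι).symm
  have h := (hH (Fintype.card ι) (b ∘ e)).preimage
    (measurePreserving_comp_equiv μ e).quasiMeasurePreserving
  convert h using 1
  ext x
  simp only [Set.mem_ofPred_eq, Set.mem_preimage, Function.comp]
  exact exists_congr fun g => and_congr_right fun _ => (e.forall_congr_right
    (q := fun j => g (x j) = b j)).symm

/-! ### The number of labelings of a sample -/

open Classical in
/-- The labelings of the points `z` by hypotheses of `H`. -/
noncomputable def labelings {X ι : Type*} [Fintype ι] (H : Set (X → Bool)) (z : ι → X) : Finset (ι → Bool) :=
  Finset.univ.filter fun b => ∃ h ∈ H, ∀ j, h (z j) = b j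

theorem mem_labelings {X ι : Type*} [Fintype ι] {H : Set (X → Bool)} {z : ι → X}
    {b : ι → Bool} : b ∈ labelings H z ↔ ∃ h ∈ H, ∀ j, h (z j) = b j := by
  simp [labelings]

open Classical in
-- Sauer–Shelah for the set family on the index type `ι` given by the positive labels. A shattered
-- set of indices maps to an equally large set of points shattered by `H`.
theorem card_labelings_le_sum_choose {X ι : Type*} [Fintype ι] {H : Set (X → Bool)} {d : ℕ}
    (hd : HasVCDim H d) (z : ι → X) :
    (labelings H z).card ≤ ∑ i ∈ Finset.range (d + 1), (Fintype.card ι).choose i := by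
  let F : (ι → Bool) → Finset ι := fun b => Finset.univ.filter fun j => b j = true
  have hF : Function.Injective F := fun b c hbc => by
    ext j
    have := Finset.ext_iff.1 hbc j
    simp only [F, Finset.mem_filter, Finset.mem_univ, true_and] at this
    exact Bool.eq_iff_iff.2 this
  let 𝒜 := (labelings H z).image F
  have hvc : 𝒜.vcDim ≤ d := by
    refine Finset.sup_le fun s hs => ?_
    have hs : 𝒜.Shatters s := Finset.mem_shatterer.1 hs
    have key : ∀ t ⊆ s, ∃ h ∈ H, ∀ j ∈ s, (h (z j) = true ↔ j ∈ t) := by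
      intro t ht
      obtain ⟨u, hu, hut⟩ := hs ht
      obtain ⟨b, hb, rfl⟩ := Finset.mem_image.1 hu
      obtain ⟨h, hh, hhb⟩ := mem_labelings.1 hb
      refine ⟨h, hh, fun j hj => ?_⟩
      rw [← hut, hhb]
      simp [F, hj]
    -- A repeated point would receive equal labels at both indices, so no hypothesis could single
    -- out one of them.
    have hinj : Set.InjOn z s := by
      intro i hi j hj hij
      obtain ⟨h, -, hh⟩ := key {i} (by simpa using hi)
      have h1 := (hh i hi).2 (by simp)
      rw [hij] at h1
      have := (hh j hj).1 h1
      simp only [Finset.mem_singleton] at this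
      exact this.symm
    rw [← Finset.card_image_of_injOn hinj]
    refine hd.2 ⟨s.image z, rfl, fun B _ => ?_⟩
    obtain ⟨h, hh, hhB⟩ := key (s.filter fun j => z j ∈ B) (Finset.filter_subset _ _)
    refine ⟨h, hh, fun x hx => ?_⟩
    obtain ⟨j, hj, rfl⟩ := Finset.mem_image.1 hx
    rw [hhB j hj]
    simp [hj]
  calc (labelings H z).card = 𝒜.card := (Finset.card_image_of_injective _ hF).symm
    _ ≤ 𝒜.shatterer.card := Finset.card_le_card_shatterer _
    _ ≤ _ := Finset.card_shatterer_le_sum_vcDim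
    _ ≤ _ := Finset.sum_le_sum_of_subset fun i hi => by
      have := Finset.mem_Iic.1 hi
      exact Finset.mem_range.2 (by omega)

theorem sum_choose_le_pow {n d : ℕ} (hd : 1 ≤ d) (hdn : d ≤ n) :
    ∑ i ∈ Finset.range (d + 1), (n.choose i : ℝ) ≤ (n * exp 1 / d) ^ d := by
  have hd0 : (0 : ℝ) < d := by exact_mod_cast hd
  have hn0 : (0 : ℝ) < n := by exact_mod_cast hd.trans hdn
  have hr0 : (0 : ℝ) < d / n := by positivity
  have hr1 : (d / n : ℝ) ≤ 1 := by
    rw [div_le_one hn0]; exact_mod_cast hdn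
  -- Since `d / n ≤ 1`, the weight `(d / n) ^ d` is at most `(d / n) ^ i` for `i ≤ d`; the weighted
  -- sum is then part of the binomial expansion of `(1 + d / n) ^ n`.
  have h1 : (∑ i ∈ Finset.range (d + 1), (n.choose i : ℝ)) * (d / n) ^ d ≤ exp d := by
    calc (∑ i ∈ Finset.range (d + 1), (n.choose i : ℝ)) * (d / n) ^ d
        ≤ ∑ i ∈ Finset.range (d + 1), (d / n : ℝ) ^ i * n.choose i := by
          rw [Finset.sum_mul]
          refine Finset.sum_le_sum fun i hi => ?_
          rw [mul_comm]
          gcongr ?_ * _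
          exact pow_le_pow_of_le_one hr0.le hr1 (by have := Finset.mem_range.1 hi; omega)
      _ ≤ ∑ i ∈ Finset.range (n + 1), (d / n : ℝ) ^ i * n.choose i := by
          refine Finset.sum_le_sum_of_subset_of_nonneg ?_ fun i _ _ => by positivity
          exact Finset.range_mono (by omega)
      _ = (d / n + 1 : ℝ) ^ n := by simp [add_pow]
      _ ≤ exp (d / n) ^ n := by gcongr; exact add_one_le_exp _
      _ = exp d := by rw [← exp_nat_mul]; congr 1; field_simp
  have h2 : (n * exp 1 / d : ℝ) ^ d = exp d / (d / n) ^ d := by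
    rw [show (n * exp 1 / d : ℝ) = exp 1 / (d / n) by field_simp, div_pow, ← exp_nat_mul, mul_one]
  rw [h2, le_div_iff₀ (by positivity)]
  exact h1

theorem card_labelings_le_pow {X ι : Type*} [Fintype ι] {H : Set (X → Bool)} {d : ℕ}
    (hH : HasVCDim H d) (hd : 1 ≤ d) (hdn : d ≤ Fintype.card ι) (z : ι → X) :
    ((labelings H z).card : ℝ) ≤ (Fintype.card ι * exp 1 / d) ^ d :=
  le_trans (by exact_mod_cast card_labelings_le_sum_choose hH z) (sum_choose_le_pow hd hdn)

/-! ### Random exchange of sample points with ghost points -/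

/-- The sample points `A` together with their ghosts `A × K`, arranged in blocks. -/
def blockEquiv (A K : Type*) : A × Option K ≃ A ⊕ A × K where
  toFun p := p.2.elim (Sum.inl p.1) fun k => Sum.inr (p.1, k)
  invFun := Sum.elim (fun a => (a, none)) fun p => (p.1, some p.2)
  left_inv := by rintro ⟨a, _ | k⟩ <;> rfl
  right_inv := by rintro (a | ⟨a, k⟩) <;> rfl

/-- Exchange, in every block `a`, the sample point with the member `σ a` of the block. -/
def blockSwap {A K : Type*} [DecidableEq K] (σ : A → Option K) : Equiv.Perm (A ⊕ A × K) :=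
  (blockEquiv A K).symm.trans
    ((Equiv.prodShear (Equiv.refl A) fun a => Equiv.swap none (σ a)).trans (blockEquiv A K))

theorem blockSwap_inl {A K : Type*} [DecidableEq K] (σ : A → Option K) (a : A) :
    blockSwap σ (Sum.inl a) = blockEquiv A K (a, σ a) := by
  simp [blockSwap, blockEquiv]

/-- The mean over the sample and the ghosts minus the mean over the sample. -/
noncomputable def ghostGap {A K : Type*} [Fintype A] [Fintype K] (v : A ⊕ A × K → ℝ) : ℝ :=
  (∑ i, v i) / (Fintype.card A * (Fintype.card K + 1)) -
    (∑ a, v (Sum.inl a)) / Fintype.card A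

theorem ghostGap_mem_Icc {A K : Type*} [Fintype A] [Nonempty A] [Fintype K] {v : A ⊕ A × K → ℝ}
    (hv : ∀ i, v i ∈ Set.Icc (0 : ℝ) 1) : ghostGap v ∈ Set.Icc (-1 : ℝ) 1 := by
  have hA : (0 : ℝ) < Fintype.card A := by exact_mod_cast Fintype.card_pos
  suffices h : ∀ p q : ℝ, 0 ≤ p → p ≤ 1 → 0 ≤ q → q ≤ 1 → p - q ∈ Set.Icc (-1 : ℝ) 1 by
    refine h _ _ ?_ ?_ ?_ ?_
    · exact div_nonneg (Finset.sum_nonneg fun i _ => (hv i).1) (by positivity)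
    · rw [div_le_one (by positivity)]
      refine (Finset.sum_le_card_nsmul _ _ 1 fun i _ => (hv i).2).trans (le_of_eq ?_)
      simp
      ring
    · exact div_nonneg (Finset.sum_nonneg fun a _ => (hv _).1) hA.le
    · rw [div_le_one hA]
      refine (Finset.sum_le_card_nsmul _ _ 1 fun a _ => (hv _).2).trans (le_of_eq ?_)
      simp
  intro p q _ _ _ _
  constructor <;> linarith

/-- The overall mean is invariant under exchanges, so only the sample mean depends on `σ`. Its
exponential is a product over blocks, and the sum over `σ` factors into independent uniform choices.
-/
theorem sum_exp_ghostGap_le {A K : Type*} [Fintype A] [DecidableEq A] [Nonempty A] [Fintype K]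
    [DecidableEq K]
    {v : A ⊕ A × K → ℝ} (hv : ∀ i, v i ∈ Set.Icc (0 : ℝ) 1) (t : ℝ) :
    ∑ σ : A → Option K, exp (t * ghostGap (v ∘ blockSwap σ)) ≤
      (Fintype.card K + 1 : ℝ) ^ Fintype.card A * exp (t ^ 2 / (8 * Fintype.card A)) := by
  have hA : (0 : ℝ) < Fintype.card A := by exact_mod_cast Fintype.card_pos
  set n : ℝ := (Fintype.card A : ℝ) with hn
  set N : ℝ := (Fintype.card K : ℝ) + 1 with hN
  have hN0 : 0 < N := by positivity
  have hcard : (Fintype.card (Option K) : ℝ) = N := by simp [hN]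
  let w : A → Option K → ℝ := fun a o => v (blockEquiv A K (a, o))
  have hsum : ∑ i, v i = ∑ a, ∑ o, w a o := by
    rw [← (blockEquiv A K).sum_comp, Fintype.sum_prod_type]
  have hterm : ∀ σ : A → Option K, exp (t * ghostGap (v ∘ blockSwap σ)) =
      exp (t * (∑ i, v i) / (n * N)) * ∏ a, exp (-(t / n) * w a (σ a)) := by
    intro σ
    rw [← exp_sum, ← exp_add, ← Finset.mul_sum]
    congr 1
    simp only [ghostGap, Function.comp, Equiv.sum_comp (blockSwap σ) v, blockSwap_inl, w]
    rw [← hn, ← hN]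
    ring
  simp_rw [hterm]
  rw [← Finset.mul_sum]
  have hprod := (Fintype.prod_sum fun a o => exp (-(t / n) * w a o)).symm
  rw [hprod]
  calc exp (t * (∑ i, v i) / (n * N)) * ∏ a, ∑ o, exp (-(t / n) * w a o)
      ≤ exp (t * (∑ i, v i) / (n * N)) *
        ∏ a, (N * exp (-(t / n) * ((∑ o, w a o) / N) + (-(t / n)) ^ 2 / 8)) := by
        gcongr with a
        have := sum_exp_mul_le (a := w a) (fun o => hv _) (-(t / n))
        rwa [hcard] at this
    -- The block means add up to the overall mean, which cancels the prefactor and leaves only the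
    -- variance terms.
    _ = _ := by
        rw [Finset.prod_mul_distrib, ← exp_sum, Finset.sum_add_distrib, ← Finset.mul_sum,
          ← Finset.sum_div, ← hsum]
        simp only [Finset.prod_const, Finset.sum_const, Finset.card_univ, nsmul_eq_mul]
        rw [← hn, mul_left_comm, ← exp_add]
        congr 2
        field_simp
        ring

section

variable {X A K : Type*} [Fintype A] [Fintype K]

/-- The exponential ghost gaps of all labelings of `z`, added up. -/
noncomputable def gapSum (H : Set (X → Bool)) (l : Bool → X → ℝ) (t : ℝ)
    (z : A ⊕ A × K → X) : ENNReal :=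
  ∑ b ∈ labelings H z, ENNReal.ofReal (exp (t * ghostGap fun i => l (b i) (z i)))

theorem gapSum_comp_perm (H : Set (X → Bool)) (l : Bool → X → ℝ) (t : ℝ)
    (z : A ⊕ A × K → X) (e : Equiv.Perm (A ⊕ A × K)) :
    gapSum H l t (z ∘ e) = ∑ b ∈ labelings H z,
      ENNReal.ofReal (exp (t * ghostGap ((fun i => l (b i) (z i)) ∘ e))) := by
  refine Finset.sum_nbij' (fun b => b ∘ e.symm) (fun b => b ∘ e) ?_ ?_ ?_ ?_ ?_
  · intro b hb
    obtain ⟨h, hh, hb⟩ := mem_labelings.1 hb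
    exact mem_labelings.2 ⟨h, hh, fun j => by simpa using hb (e.symm j)⟩
  · intro b hb
    obtain ⟨h, hh, hb⟩ := mem_labelings.1 hb
    exact mem_labelings.2 ⟨h, hh, fun j => by simpa using hb (e j)⟩
  · intro b _; ext; simp
  · intro b _; ext; simp
  · intro b _; simp [Function.comp_def]

variable [MeasurableSpace X]

theorem measurable_exp_ghostGap {Ω : Type*} [MeasurableSpace Ω]
    {v : Ω → A ⊕ A × K → ℝ} (hv : ∀ i, Measurable fun ω => v ω i) (t : ℝ) :
    Measurable fun ω => exp (t * ghostGap (v ω)) := by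
  unfold ghostGap
  fun_prop

theorem aemeasurable_gapSum {H : Set (X → Bool)} {μ : Measure X} [IsProbabilityMeasure μ]
    (hH : SampleMeasurable H μ) {l : Bool → X → ℝ} (hl : ∀ b, Measurable (l b)) (t : ℝ) :
    AEMeasurable (gapSum (A := A) (K := K) H l t) (Measure.pi fun _ => μ) := by
  classical
  -- Summing over all patterns with indicators isolates the dependence on `H` in the events that
  -- `SampleMeasurable` controls.
  have : gapSum (A := A) (K := K) H l t = fun z => ∑ b : A ⊕ A × K → Bool,
      Set.indicator {z | ∃ h ∈ H, ∀ j, h (z j) = b j}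
        (fun z => ENNReal.ofReal (exp (t * ghostGap fun i => l (b i) (z i)))) z := by
    ext z
    rw [gapSum, labelings, Finset.sum_filter]
    simp only [Set.indicator_apply, Set.mem_ofPred_eq]
    congr!
  rw [this]
  refine Finset.aemeasurable_fun_sum _ fun b _ => ?_
  refine AEMeasurable.indicator₀ ?_ (hH.nullMeasurableSet b)
  refine (measurable_exp_ghostGap (fun i => ?_) t).ennreal_ofReal.aemeasurable
  exact (hl _).comp (measurable_pi_apply i)

/-- The product law is invariant under every `blockSwap σ`, so the integral equals its average over
`σ`. Averaging inside the integral gives a pointwise bound: at most `S` labelings, each controlled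
by `sum_exp_ghostGap_le`. -/
theorem lintegral_gapSum_le [Nonempty A] {H : Set (X → Bool)} {μ : Measure X}
    [IsProbabilityMeasure μ] (hH : SampleMeasurable H μ) {l : Bool → X → ℝ}
    (hl : ∀ b, Measurable (l b)) (hl01 : ∀ b x, l b x ∈ Set.Icc (0 : ℝ) 1) {S : ℝ}
    (hS : ∀ z : A ⊕ A × K → X, ((labelings H z).card : ℝ) ≤ S) (t : ℝ) :
    ∫⁻ z, gapSum (A := A) (K := K) H l t z ∂(Measure.pi fun _ => μ) ≤
      ENNReal.ofReal (S * exp (t ^ 2 / (8 * Fintype.card A))) := by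
  classical
  set P : Measure (A ⊕ A × K → X) := Measure.pi fun _ => μ
  set c : ℝ := (Fintype.card K + 1 : ℝ) ^ Fintype.card A with hc
  have hc0 : 0 < c := by positivity
  have hmeas := aemeasurable_gapSum (A := A) (K := K) hH hl t
  have hmp := fun σ : A → Option K => measurePreserving_comp_equiv μ (blockSwap σ)
  have hinv : ∀ σ : A → Option K, ∫⁻ z, gapSum H l t (z ∘ blockSwap σ) ∂P =
      ∫⁻ z, gapSum H l t z ∂P := by
    intro σ
    have h := lintegral_map' (μ := P) (f := gapSum H l t) (g := fun z => z ∘ blockSwap σ)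
      (by rw [(hmp σ).map_eq]; exact hmeas) (hmp σ).measurable.aemeasurable
    rw [(hmp σ).map_eq] at h
    exact h.symm
  have hpt : ∀ z : A ⊕ A × K → X, ∑ σ : A → Option K, gapSum H l t (z ∘ blockSwap σ) ≤
      ENNReal.ofReal (c * (S * exp (t ^ 2 / (8 * Fintype.card A)))) := by
    intro z
    simp_rw [gapSum_comp_perm]
    rw [Finset.sum_comm]
    simp_rw [← ENNReal.ofReal_sum_of_nonneg fun _ _ => (exp_pos _).le]
    rw [← ENNReal.ofReal_sum_of_nonneg fun _ _ => Finset.sum_nonneg fun _ _ => (exp_pos _).le]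
    refine ENNReal.ofReal_le_ofReal ?_
    calc _ ≤ ∑ b ∈ labelings H z, c * exp (t ^ 2 / (8 * Fintype.card A)) :=
          Finset.sum_le_sum fun b _ => sum_exp_ghostGap_le (fun i => hl01 _ _) t
      _ = (labelings H z).card * (c * exp (t ^ 2 / (8 * Fintype.card A))) := by
          rw [Finset.sum_const, nsmul_eq_mul]
      _ ≤ S * (c * exp (t ^ 2 / (8 * Fintype.card A))) := by gcongr; exact hS z
      _ = _ := by ring
  have htot : ENNReal.ofReal c * ∫⁻ z, gapSum H l t z ∂P ≤
      ENNReal.ofReal c * ENNReal.ofReal (S * exp (t ^ 2 / (8 * Fintype.card A))) := by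
    rw [← ENNReal.ofReal_mul hc0.le]
    calc ENNReal.ofReal c * ∫⁻ z, gapSum H l t z ∂P
        = ∑ σ : A → Option K, ∫⁻ z, gapSum H l t (z ∘ blockSwap σ) ∂P := by
          simp_rw [hinv]
          rw [Finset.sum_const, nsmul_eq_mul, Finset.card_univ, hc]
          congr 1
          rw [Fintype.card_fun, Fintype.card_option, ← ENNReal.ofReal_natCast]
          push_cast
          rfl
      _ = ∫⁻ z, ∑ σ : A → Option K, gapSum H l t (z ∘ blockSwap σ) ∂P := by
          rw [lintegral_finsetSum']
          intro σ _
          exact hmeas.comp_quasiMeasurePreserving (hmp σ).quasiMeasurePreserving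
      _ ≤ ∫⁻ _, ENNReal.ofReal (c * (S * exp (t ^ 2 / (8 * Fintype.card A)))) ∂P :=
          lintegral_mono hpt
      _ = _ := by simp
  exact (ENNReal.mul_le_mul_iff_right (by simpa using hc0) ENNReal.ofReal_ne_top).1 htot

/-- For fixed `h`, averaging `ghostGap` over the ghosts yields the true deviation times `K / (K +
1)`, the fraction of ghosts in a block. Jensen's inequality moves the exponential inside, so no
separate concentration of the ghosts is needed. -/
theorem exp_le_lintegral_gapSum [Nonempty A] [Nonempty K] {H : Set (X → Bool)} {μ : Measure X}
    [IsProbabilityMeasure μ] {l : Bool → X → ℝ}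
    (hl : ∀ b, Measurable (l b)) (hl01 : ∀ b x, l b x ∈ Set.Icc (0 : ℝ) 1) (t : ℝ)
    {h : X → Bool} (hh : h ∈ H) (hhm : Measurable h) (x : A → X) :
    ENNReal.ofReal (exp (t * (Fintype.card K / (Fintype.card K + 1) *
      (∫ y, l (h y) y ∂μ - (∑ a, l (h (x a)) (x a)) / Fintype.card A)))) ≤
    ∫⁻ w, gapSum (A := A) (K := K) H l t (Sum.elim x w) ∂(Measure.pi fun _ => μ) := by
  have hA : (0 : ℝ) < Fintype.card A := by exact_mod_cast Fintype.card_pos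
  set P : Measure (A × K → X) := Measure.pi fun _ => μ with hP
  have hgm : Measurable fun y => l (h y) y := by
    have : (fun y => l (h y) y) = fun y => if h y = true then l true y else l false y := by
      ext y; cases h y <;> rfl
    rw [this]
    exact Measurable.ite (hhm (measurableSet_singleton true)) (hl _) (hl _)
  set R := ∫ y, l (h y) y ∂μ with hR
  let gap : (A × K → X) → ℝ := fun w =>
    ghostGap (A := A) (K := K) fun i => l (h (Sum.elim x w i)) (Sum.elim x w i)
  have hbd : ∀ i : A × K, Integrable (fun w : A × K → X => l (h (w i)) (w i)) P := fun i =>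
    Integrable.of_mem_Icc 0 1 (hgm.comp (measurable_pi_apply i)).aemeasurable
      (Filter.Eventually.of_forall fun w => hl01 _ _)
  have hgap : gap = fun w => (∑ a, l (h (x a)) (x a) + ∑ i, l (h (w i)) (w i)) /
      (Fintype.card A * (Fintype.card K + 1)) - (∑ a, l (h (x a)) (x a)) / Fintype.card A := by
    ext w
    simp [gap, ghostGap, Fintype.sum_sum_type]
  have hsumint : Integrable (fun w : A × K → X => ∑ i, l (h (w i)) (w i)) P :=
    integrable_finsetSum _ fun i _ => hbd i
  have hint : Integrable gap P := by
    rw [hgap]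
    exact (((integrable_const _).add hsumint).div_const _).sub (integrable_const _)
  have hval : ∫ w, gap w ∂P = Fintype.card K / (Fintype.card K + 1) *
      (R - (∑ a, l (h (x a)) (x a)) / Fintype.card A) := by
    have h1 : ∀ i : A × K, ∫ w, l (h (w i)) (w i) ∂P = R := fun i =>
      integral_comp_eval (μ := fun _ => μ) (f := fun y => l (h y) y) hgm.aestronglyMeasurable
    simp only [hgap]
    rw [integral_sub (f := fun w : A × K → X => (∑ a, l (h (x a)) (x a) +
        ∑ i, l (h (w i)) (w i)) / (Fintype.card A * (Fintype.card K + 1)))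
        (((integrable_const _).add hsumint).div_const _) (integrable_const _),
      integral_div, integral_add (integrable_const _) hsumint,
      integral_finsetSum _ fun i _ => hbd i]
    simp only [h1, integral_const, probReal_univ, smul_eq_mul, one_mul, Finset.sum_const,
      Finset.card_univ, Fintype.card_prod, nsmul_eq_mul, Nat.cast_mul]
    field_simp
    ring
  have hmg : Measurable gap := by
    rw [hgap]
    have : ∀ i : A × K, Measurable fun w : A × K → X => l (h (w i)) (w i) :=
      fun i => hgm.comp (measurable_pi_apply i)
    exact (((Finset.measurable_fun_sum _ fun i _ => this i).const_add _).div_const _).sub_const _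
  have hexp : Integrable (fun w => exp (t * gap w)) P :=
    ProbabilityTheory.integrable_exp_mul_of_mem_Icc hmg.aemeasurable
      (Filter.Eventually.of_forall fun w => ghostGap_mem_Icc fun i => hl01 _ _)
  calc _ = ENNReal.ofReal (exp (t * ∫ w, gap w ∂P)) := by rw [hval]
    _ ≤ ENNReal.ofReal (∫ w, exp (t * gap w) ∂P) := by
        refine ENNReal.ofReal_le_ofReal ?_
        rw [← integral_const_mul]
        exact convexOn_exp.map_integral_le continuous_exp.continuousOn isClosed_univ
          (by simp) (hint.const_mul t) hexp
    _ = ∫⁻ w, ENNReal.ofReal (exp (t * gap w)) ∂P :=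
        ofReal_integral_eq_lintegral_ofReal hexp
          (Filter.Eventually.of_forall fun w => (exp_pos _).le)
    _ ≤ _ := by
        -- The labeling by `h` itself is one of the nonnegative terms of `gapSum`.
        refine lintegral_mono fun w => ?_
        refine Finset.single_le_sum (f := fun b : A ⊕ A × K → Bool =>
          ENNReal.ofReal (exp (t * ghostGap fun i => l (b i) (Sum.elim x w i))))
          (fun _ _ => zero_le) (mem_labelings.2 ⟨h, hh, fun j => rfl⟩)

/-- The uniform one-sided deviation bound for a class with at most `S` labelings: the exceptional
set need not be measurable. -/
theorem measure_exists_risk_gt_le [Nonempty A] [Nonempty K] {H : Set (X → Bool)} {μ : Measure X}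
    [IsProbabilityMeasure μ] (hH : SampleMeasurable H μ) (hHm : ∀ h ∈ H, Measurable h)
    {l : Bool → X → ℝ}
    (hl : ∀ b, Measurable (l b)) (hl01 : ∀ b x, l b x ∈ Set.Icc (0 : ℝ) 1) {S : ℝ}
    (hS : ∀ z : A ⊕ A × K → X, ((labelings H z).card : ℝ) ≤ S) {t : ℝ} (ht : 0 ≤ t) (U : ℝ) :
    (Measure.pi fun _ : A => μ)
      {x | ∃ h ∈ H, (∑ a, l (h (x a)) (x a)) / Fintype.card A + U < ∫ y, l (h y) y ∂μ} ≤
      ENNReal.ofReal (S * exp (t ^ 2 / (8 * Fintype.card A) -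
        t * (Fintype.card K / (Fintype.card K + 1) * U))) := by
  set F : (A → X) → ENNReal := fun x =>
    ∫⁻ w, gapSum (A := A) (K := K) H l t (Sum.elim x w) ∂(Measure.pi fun _ => μ) with hF
  have hmp := measurePreserving_sumElim (ι := A) (κ := A × K) μ
  have hmeas := aemeasurable_gapSum (A := A) (K := K) hH hl t
  have hcomp := hmeas.comp_quasiMeasurePreserving hmp.quasiMeasurePreserving
  have hFm : AEMeasurable F (Measure.pi fun _ => μ) := hcomp.lintegral_prod_right'
  have hFint : ∫⁻ x, F x ∂(Measure.pi fun _ => μ) ≤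
      ENNReal.ofReal (S * exp (t ^ 2 / (8 * Fintype.card A))) := by
    refine le_trans (le_of_eq ?_) (lintegral_gapSum_le hH hl hl01 hS t)
    have h1 := lintegral_map' (f := gapSum (A := A) (K := K) H l t)
      (by rw [hmp.map_eq]; exact hmeas) hmp.measurable.aemeasurable
    rw [hmp.map_eq] at h1
    exact (h1.trans (lintegral_prod _ hcomp)).symm
  set E := exp (t * (Fintype.card K / (Fintype.card K + 1) * U)) with hE
  have hE0 : 0 < E := exp_pos _
  -- `F` does not depend on `h`, so a single level set covers the bad events of all hypotheses, and
  -- Markov's inequality applies to it.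
  have hsub : {x : A → X | ∃ h ∈ H, (∑ a, l (h (x a)) (x a)) / Fintype.card A + U <
      ∫ y, l (h y) y ∂μ} ⊆ {x | ENNReal.ofReal E ≤ F x} := by
    rintro x ⟨h, hh, hx⟩
    refine le_trans (ENNReal.ofReal_le_ofReal ?_)
      (exp_le_lintegral_gapSum hl hl01 t hh (hHm h hh) x)
    rw [hE]
    gcongr
    linarith
  have hmarkov := (mul_meas_ge_le_lintegral₀ hFm (ENNReal.ofReal E)).trans hFint
  rw [exp_sub, ← mul_div_assoc, ENNReal.ofReal_div_of_pos hE0]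
  rw [ENNReal.le_div_iff_mul_le (by simp [hE0]) (by simp), mul_comm]
  exact (mul_le_mul_right (measure_mono hsub) _).trans hmarkov

end

/-! ### A fixed event under two samples -/

/-- Chernoff's bound at the parameter `2 * m * τ`: each sample contributes `exp (m * τ ^ 2 / 2)` to
the moment generating function, against `exp (-(2 * m * τ ^ 2))`. -/
theorem measureReal_two_sample_le {X : Type*} [MeasurableSpace X] {m : ℕ} (hm : 1 ≤ m)
    (μ ν : Measure X) [IsProbabilityMeasure μ] [IsProbabilityMeasure ν] {f g : X → ℝ}
    (hf : Measurable f) (hf01 : ∀ x, f x ∈ Set.Icc (0 : ℝ) 1)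
    (hg : Measurable g) (hg01 : ∀ x, g x ∈ Set.Icc (0 : ℝ) 1) {τ : ℝ} (hτ : 0 ≤ τ) :
    ((Measure.pi fun _ : Fin m => μ).prod (Measure.pi fun _ : Fin m => ν)).real
      {p | τ ≤ (∫ x, f x ∂μ - (∑ j, f (p.1 j)) / m) + (∫ x, g x ∂ν - (∑ j, g (p.2 j)) / m)} ≤
      exp (-(m * τ ^ 2)) := by
  have hm0 : (0 : ℝ) < m := by exact_mod_cast hm
  set P := (Measure.pi fun _ : Fin m => μ).prod (Measure.pi fun _ : Fin m => ν) with hP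
  have hexp : ∀ (ρ : Measure X) [IsProbabilityMeasure ρ] (u : X → ℝ), Measurable u →
      (∀ x, u x ∈ Set.Icc (0 : ℝ) 1) →
      ∫ x, ∏ j : Fin m, exp (-(2 * τ) * (u (x j) - ∫ y, u y ∂ρ)) ∂(Measure.pi fun _ => ρ) ≤
        exp (m * τ ^ 2 / 2) := by
    intro ρ _ u hu hu01
    rw [integral_fintype_prod_eq_pow (fun x => exp (-(2 * τ) * (u x - ∫ y, u y ∂ρ))),
      Fintype.card_fin]
    calc _ ≤ exp ((-(2 * τ)) ^ 2 / 8) ^ m :=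
          pow_le_pow_left₀ (integral_nonneg fun x => (exp_pos _).le)
            (integral_exp_mul_sub_integral_le ρ hu hu01 _) m
      _ = _ := by rw [← exp_nat_mul]; ring_nf
  set W : (Fin m → X) × (Fin m → X) → ℝ := fun p =>
    (∫ x, f x ∂μ - (∑ j, f (p.1 j)) / m) + (∫ x, g x ∂ν - (∑ j, g (p.2 j)) / m) with hW
  have hsplit : ∀ p, exp (2 * m * τ * W p) =
      (∏ j, exp (-(2 * τ) * (f (p.1 j) - ∫ y, f y ∂μ))) *
        ∏ j, exp (-(2 * τ) * (g (p.2 j) - ∫ y, g y ∂ν)) := by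
    intro p
    rw [← exp_sum, ← exp_sum, ← exp_add, ← Finset.mul_sum, ← Finset.mul_sum]
    congr 1
    simp only [hW, Finset.sum_sub_distrib, Finset.sum_const, Finset.card_univ, Fintype.card_fin,
      nsmul_eq_mul]
    field_simp
    ring
  have hWm : Measurable W := by
    have h1 : ∀ j : Fin m, Measurable fun p : (Fin m → X) × (Fin m → X) => f (p.1 j) :=
      fun j => hf.comp ((measurable_pi_apply j).comp measurable_fst)
    have h2 : ∀ j : Fin m, Measurable fun p : (Fin m → X) × (Fin m → X) => g (p.2 j) :=
      fun j => hg.comp ((measurable_pi_apply j).comp measurable_snd)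
    exact (((Finset.measurable_fun_sum _ fun j _ => h1 j).div_const _).const_sub _).add
      (((Finset.measurable_fun_sum _ fun j _ => h2 j).div_const _).const_sub _)
  have hmean : ∀ u : X → ℝ, (∀ x, u x ∈ Set.Icc (0 : ℝ) 1) → ∀ x : Fin m → X,
      (∑ j, u (x j)) / m ∈ Set.Icc (0 : ℝ) 1 := by
    intro u hu x
    refine ⟨div_nonneg (Finset.sum_nonneg fun j _ => (hu _).1) hm0.le, ?_⟩
    rw [div_le_one hm0]
    refine (Finset.sum_le_card_nsmul _ _ 1 fun j _ => (hu _).2).trans (le_of_eq ?_)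
    simp
  have hWb : ∀ p, W p ∈ Set.Icc (∫ x, f x ∂μ - 1 + (∫ x, g x ∂ν - 1))
      (∫ x, f x ∂μ + ∫ x, g x ∂ν) := by
    intro p
    have h1 := hmean f hf01 p.1
    have h2 := hmean g hg01 p.2
    exact ⟨by simp only [hW]; linarith [h1.2, h2.2], by simp only [hW]; linarith [h1.1, h2.1]⟩
  have hint := ProbabilityTheory.integrable_exp_mul_of_mem_Icc (μ := P) (t := 2 * m * τ)
    hWm.aemeasurable (Filter.Eventually.of_forall hWb)
  have h := ProbabilityTheory.measure_ge_le_exp_mul_mgf (μ := P) (X := W) τ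
    (t := 2 * m * τ) (by positivity) hint
  refine h.trans ?_
  have hmgf : ProbabilityTheory.mgf W P (2 * m * τ) ≤ exp (m * τ ^ 2 / 2) * exp (m * τ ^ 2 / 2) := by
    rw [ProbabilityTheory.mgf]
    simp_rw [hsplit]
    rw [integral_prod_mul (fun x : Fin m → X => ∏ j, exp (-(2 * τ) * (f (x j) - ∫ y, f y ∂μ)))
      (fun x : Fin m → X => ∏ j, exp (-(2 * τ) * (g (x j) - ∫ y, g y ∂ν)))]
    exact mul_le_mul (hexp μ f hf hf01) (hexp ν g hg hg01)
      (integral_nonneg fun x => Finset.prod_nonneg fun j _ => (exp_pos _).le) (exp_pos _).le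
  calc _ ≤ exp (-(2 * m * τ) * τ) * (exp (m * τ ^ 2 / 2) * exp (m * τ ^ 2 / 2)) := by gcongr
    _ = _ := by rw [← exp_add, ← exp_add]; ring_nf

theorem isProbabilityMeasure_empMeasure {X : Type*} [MeasurableSpace X] {m : ℕ} (hm : 1 ≤ m)
    (x : Fin m → X) : IsProbabilityMeasure (empMeasure x) := ⟨by
  simp only [empMeasure, Measure.smul_apply, Measure.finsetSum_apply, measure_univ,
    Finset.sum_const, Finset.card_univ, Fintype.card_fin, smul_eq_mul, nsmul_eq_mul, mul_one]
  exact ENNReal.inv_mul_cancel (by exact_mod_cast (by omega : m ≠ 0)) (by simp)⟩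

theorem empMeasure_real {X : Type*} [MeasurableSpace X] {m : ℕ} (x : Fin m → X) {A : Set X}
    (hA : MeasurableSet A) :
    (empMeasure x).real A = (∑ j, A.indicator (fun _ => (1 : ℝ)) (x j)) / m := by
  simp only [empMeasure, measureReal_def, Measure.smul_apply, smul_eq_mul, ENNReal.toReal_mul,
    Measure.finsetSum_apply]
  rw [ENNReal.toReal_sum (fun j _ => measure_ne_top _ _)]
  rw [div_eq_inv_mul]
  simp only [ENNReal.toReal_inv, ENNReal.toReal_natCast]
  congr 1
  refine Finset.sum_congr rfl fun j _ => ?_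
  rw [Measure.dirac_apply' _ hA]
  by_cases h : x j ∈ A <;> simp [h]

theorem exists_event_abs_sub_le {X : Type*} [MeasurableSpace X] {m : ℕ} (hm : 1 ≤ m)
    (μ ν : Measure X) [IsProbabilityMeasure μ] [IsProbabilityMeasure ν] {A : Set X}
    (hA : MeasurableSet A) {τ : ℝ} (hτ : 0 ≤ τ) :
    ∃ E : Set ((Fin m → X) × (Fin m → X)), MeasurableSet E ∧
      ((Measure.pi fun _ => μ).prod (Measure.pi fun _ => ν)).real E ≤ exp (-(m * τ ^ 2)) ∧
      ∀ p ∉ E, |μ.real A - ν.real A| ≤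
        |(empMeasure p.1).real A - (empMeasure p.2).real A| + τ := by
  have key : ∀ B : Set X, MeasurableSet B → ∃ E : Set ((Fin m → X) × (Fin m → X)),
      MeasurableSet E ∧
      ((Measure.pi fun _ => μ).prod (Measure.pi fun _ => ν)).real E ≤ exp (-(m * τ ^ 2)) ∧
      ∀ p ∉ E, μ.real B - ν.real B ≤ (empMeasure p.1).real B - (empMeasure p.2).real B + τ := by
    intro B hB
    -- Using `Bᶜ` under `ν` reverses the sign of the second deviation, so the two add up to that of
    -- `μ.real B - ν.real B`.
    set E := toMeasurable ((Measure.pi fun _ : Fin m => μ).prod (Measure.pi fun _ : Fin m => ν))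
      {p | τ ≤ (∫ x, B.indicator (fun _ => (1 : ℝ)) x ∂μ -
          (∑ j, B.indicator (fun _ => (1 : ℝ)) (p.1 j)) / m) +
        (∫ x, Bᶜ.indicator (fun _ => (1 : ℝ)) x ∂ν -
          (∑ j, Bᶜ.indicator (fun _ => (1 : ℝ)) (p.2 j)) / m)} with hE
    have hi : ∀ C : Set X, ∀ x, C.indicator (fun _ => (1 : ℝ)) x ∈ Set.Icc (0 : ℝ) 1 := by
      intro C x
      by_cases h : x ∈ C <;> simp [h]
    refine ⟨E, measurableSet_toMeasurable _ _, ?_, fun p hp => ?_⟩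
    · rw [hE, measureReal_def, measure_toMeasurable, ← measureReal_def]
      exact measureReal_two_sample_le hm μ ν (measurable_const.indicator hB) (hi B)
        (measurable_const.indicator hB.compl) (hi Bᶜ) hτ
    · have hp' : p ∉ {p : (Fin m → X) × (Fin m → X) |
          τ ≤ (∫ x, B.indicator (fun _ => (1 : ℝ)) x ∂μ -
          (∑ j, B.indicator (fun _ => (1 : ℝ)) (p.1 j)) / m) +
        (∫ x, Bᶜ.indicator (fun _ => (1 : ℝ)) x ∂ν -
          (∑ j, Bᶜ.indicator (fun _ => (1 : ℝ)) (p.2 j)) / m)} :=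
        fun h => hp (subset_toMeasurable _ _ h)
      rw [Set.mem_ofPred_eq, not_le, ← empMeasure_real _ hB, ← empMeasure_real _ hB.compl,
        integral_indicator_const _ hB, integral_indicator_const _ hB.compl] at hp'
      have := isProbabilityMeasure_empMeasure hm p.2
      rw [probReal_compl_eq_one_sub hB, probReal_compl_eq_one_sub hB] at hp'
      simp only [smul_eq_mul, mul_one] at hp'
      linarith
  -- The sign of the true difference is deterministic, so a one-sided bound for `A` or for `Aᶜ`
  -- suffices and no factor 2 is lost.
  rcases le_total (ν.real A) (μ.real A) with h | h
  · obtain ⟨E, hE, hE1, hE2⟩ := key A hA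
    refine ⟨E, hE, hE1, fun p hp => ?_⟩
    rw [abs_of_nonneg (sub_nonneg.2 h)]
    have := le_abs_self ((empMeasure p.1).real A - (empMeasure p.2).real A)
    linarith [hE2 p hp]
  · obtain ⟨E, hE, hE1, hE2⟩ := key Aᶜ hA.compl
    refine ⟨E, hE, hE1, fun p hp => ?_⟩
    rw [abs_of_nonpos (sub_nonpos.2 h)]
    have h1 := neg_abs_le ((empMeasure p.1).real A - (empMeasure p.2).real A)
    have h2 := hE2 p hp
    have := isProbabilityMeasure_empMeasure hm p.1
    have := isProbabilityMeasure_empMeasure hm p.2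
    rw [probReal_compl_eq_one_sub hA, probReal_compl_eq_one_sub hA,
      probReal_compl_eq_one_sub hA, probReal_compl_eq_one_sub hA] at h2
    linarith

/-! ### Divergences and risks -/

theorem abs_measureReal_sub_le_one {X : Type*} [MeasurableSpace X] (μ ν : Measure X)
    [IsProbabilityMeasure μ] [IsProbabilityMeasure ν] (A : Set X) :
    |μ.real A - ν.real A| ≤ 1 := by
  rw [abs_le]
  have h1 : μ.real A ≤ 1 := measureReal_le_one
  have h2 : ν.real A ≤ 1 := measureReal_le_one
  have h3 : 0 ≤ μ.real A := measureReal_nonneg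
  have h4 : 0 ≤ ν.real A := measureReal_nonneg
  constructor <;> linarith

theorem abs_measureReal_sub_le_hDiv {X : Type*} [MeasurableSpace X] {H : Set (X → Bool)}
    (μ ν : Measure X) [IsProbabilityMeasure μ] [IsProbabilityMeasure ν] {A : Set X}
    (hA : A ∈ supports H) : |μ.real A - ν.real A| ≤ 1 / 2 * hDiv H μ ν := by
  have h := le_ciSup (f := fun A : supports H => |μ.real A - ν.real A|)
    ⟨1, by rintro _ ⟨B, rfl⟩; exact abs_measureReal_sub_le_one μ ν _⟩ ⟨A, hA⟩
  rw [hDiv]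
  linarith

theorem exists_hDiv_lt {X : Type*} [MeasurableSpace X] {H : Set (X → Bool)} (hH : H.Nonempty)
    (μ ν : Measure X) {η : ℝ} (hη : 0 < η) :
    ∃ A ∈ supports H, 1 / 2 * hDiv H μ ν < |μ.real A - ν.real A| + η := by
  obtain ⟨h, hh⟩ := hH
  have : Nonempty (supports H) := ⟨⟨_, h, hh, rfl⟩⟩
  obtain ⟨⟨A, hA⟩, hlt⟩ := exists_lt_of_lt_ciSup
    (sub_lt_self (⨆ A : supports H, |μ.real A - ν.real A|) hη)
  refine ⟨A, hA, ?_⟩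
  rw [hDiv]
  linarith

theorem hDivMulti_nonneg {X : Type*} [MeasurableSpace X] {k : ℕ} (H : Set (X → Bool))
    (μ : Measure X) (ν : Fin k → Measure X) : 0 ≤ hDivMulti H μ ν :=
  Real.iSup_nonneg fun _ => mul_nonneg zero_le_two (Real.iSup_nonneg fun _ => abs_nonneg _)

theorem empRisk_nonneg {X : Type*} {m : ℕ} (x : Fin m → X) (f : X → ℝ) (h : X → Bool) :
    0 ≤ empRisk x f h :=
  div_nonneg (Finset.sum_nonneg fun _ _ => abs_nonneg _) (Nat.cast_nonneg m)

theorem risk_nonneg {X : Type*} [MeasurableSpace X] (μ : Measure X) (f : X → ℝ) (h : X → Bool) :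
    0 ≤ risk μ f h :=
  integral_nonneg fun _ => abs_nonneg _

theorem abs_bit_sub_mem_Icc {y : ℝ} (hy : y ∈ Set.Icc (0 : ℝ) 1) (b : Bool) :
    |bit b - y| ∈ Set.Icc (0 : ℝ) 1 := by
  refine ⟨abs_nonneg _, abs_le.2 ?_⟩
  obtain ⟨h0, h1⟩ := hy
  cases b <;> simp only [bit] <;> constructor <;> norm_num <;> linarith

theorem measurable_bit : Measurable bit := measurable_of_countable _

theorem integrable_loss {X : Type*} [MeasurableSpace X] {μ : Measure X} [IsProbabilityMeasure μ]
    {f : X → ℝ} (hf : Measurable f) (hf01 : ∀ x, f x ∈ Set.Icc (0 : ℝ) 1) {h : X → Bool}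
    (hh : Measurable h) : Integrable (fun x => |bit (h x) - f x|) μ :=
  Integrable.of_mem_Icc 0 1 ((measurable_bit.comp hh).sub hf).abs.aemeasurable
    (Filter.Eventually.of_forall fun x => abs_bit_sub_mem_Icc (hf01 x) _)

theorem measurableSet_xor {X : Type*} [MeasurableSpace X] {h h' : X → Bool} (hh : Measurable h)
    (hh' : Measurable h') : MeasurableSet {x | xor (h x) (h' x) = true} := by
  have : {x | xor (h x) (h' x) = true} = {x | h x = h' x}ᶜ := by
    ext x
    simp
  rw [this]
  exact (measurableSet_eq_fun hh hh').compl

theorem risk_le_risk_add {X : Type*} [MeasurableSpace X] {μ : Measure X} [IsProbabilityMeasure μ]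
    {f : X → ℝ} (hf : Measurable f) (hf01 : ∀ x, f x ∈ Set.Icc (0 : ℝ) 1) {h h' : X → Bool}
    (hh : Measurable h) (hh' : Measurable h') :
    risk μ f h ≤ risk μ f h' + μ.real {x | xor (h x) (h' x) = true} := by
  have hm := measurableSet_xor hh hh'
  have hi : Integrable ({x | xor (h x) (h' x) = true}.indicator fun _ => (1 : ℝ)) μ :=
    (integrable_const 1).indicator hm
  have h1 : μ.real {x | xor (h x) (h' x) = true} =
      ∫ x, {x | xor (h x) (h' x) = true}.indicator (fun _ => (1 : ℝ)) x ∂μ := by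
    rw [integral_indicator_const _ hm]; simp
  rw [h1, risk, risk, ← integral_add (integrable_loss hf hf01 hh') hi]
  refine integral_mono (integrable_loss hf hf01 hh) ((integrable_loss hf hf01 hh').add hi)
    fun x => ?_
  have h0 := (abs_bit_sub_mem_Icc (hf01 x) (h x)).2
  have h1 := abs_nonneg (bit (h' x) - f x)
  by_cases hx : h x = h' x
  · simp [hx]
  · have hx' : x ∈ {x | xor (h x) (h' x) = true} := by simpa using hx
    simp only [Set.indicator_of_mem hx']
    linarith

/-- Where `h` and `h'` disagree, their losses are `|1 - f x|` and `|f x|`, with sum at least 1. -/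
theorem measureReal_xor_le {X : Type*} [MeasurableSpace X] {μ : Measure X}
    [IsProbabilityMeasure μ] {f : X → ℝ} (hf : Measurable f)
    (hf01 : ∀ x, f x ∈ Set.Icc (0 : ℝ) 1) {h h' : X → Bool}
    (hh : Measurable h) (hh' : Measurable h') :
    μ.real {x | xor (h x) (h' x) = true} ≤ risk μ f h + risk μ f h' := by
  have hm := measurableSet_xor hh hh'
  have hi : Integrable ({x | xor (h x) (h' x) = true}.indicator fun _ => (1 : ℝ)) μ :=
    (integrable_const 1).indicator hm
  have h1 : μ.real {x | xor (h x) (h' x) = true} =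
      ∫ x, {x | xor (h x) (h' x) = true}.indicator (fun _ => (1 : ℝ)) x ∂μ := by
    rw [integral_indicator_const _ hm]; simp
  rw [h1, risk, risk, ← integral_add (integrable_loss hf hf01 hh) (integrable_loss hf hf01 hh')]
  refine integral_mono hi ((integrable_loss hf hf01 hh).add (integrable_loss hf hf01 hh'))
    fun x => ?_
  have h2 := abs_sub_abs_le_abs_sub (1 - f x) 0
  have h3 := le_abs_self (1 - f x)
  have h4 := le_abs_self (0 - f x)
  have h5 := neg_abs_le (0 - f x)
  rcases hb : h x <;> rcases hc : h' x <;> simp_all [bit] <;>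
    linarith [abs_nonneg (1 - f x), abs_nonneg (f x), le_abs_self (f x)]

/-- The domain adaptation inequality for the true distributions, from the source `i`. -/
theorem risk_le_add_hDiv_add_optRisk {X : Type*} [MeasurableSpace X] {k : ℕ}
    {DT : Measure X} [IsProbabilityMeasure DT] {fT : X → ℝ}
    {DS : Fin k → Measure X} [∀ i, IsProbabilityMeasure (DS i)] {fS : Fin k → X → ℝ}
    (hfT : Measurable fT) (hfT01 : ∀ x, fT x ∈ Set.Icc (0 : ℝ) 1)
    (hfS : ∀ i, Measurable (fS i)) (hfS01 : ∀ i x, fS i x ∈ Set.Icc (0 : ℝ) 1)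
    {H : Set (X → Bool)} (hH : ∀ h ∈ H, Measurable h) (i : Fin k) {h : X → Bool} (hh : h ∈ H) :
    risk DT fT h ≤ risk (DS i) (fS i) h + 1 / 2 * hDiv (symmDiffClass H) DT (DS i) +
      optRisk H DT fT DS fS := by
  rw [← sub_le_iff_le_add']
  have : Nonempty H := ⟨⟨h, hh⟩⟩
  -- For each comparison hypothesis `g`, pass from `h` to `g` under the target, transfer the
  -- disagreement set to the source at the cost of half the divergence, and bound it there by the
  -- two source risks.
  refine le_ciInf fun ⟨g, hg⟩ => ?_
  have h1 := risk_le_risk_add (μ := DT) hfT hfT01 (hH h hh) (hH g hg)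
  have h2 := measureReal_xor_le (μ := DS i) (hfS i) (hfS01 i) (hH h hh) (hH g hg)
  have h3 : |DT.real {x | xor (h x) (g x) = true} - (DS i).real {x | xor (h x) (g x) = true}| ≤ _ :=
    abs_measureReal_sub_le_hDiv DT (DS i) (H := symmDiffClass H)
      ⟨fun x => xor (h x) (g x), ⟨h, hh, g, hg, rfl⟩, rfl⟩
  have h4 := le_ciSup (Set.finite_range fun i => risk (DS i) (fS i) g).bddAbove i
  have h5 := le_abs_self
    (DT.real {x | xor (h x) (g x) = true} - (DS i).real {x | xor (h x) (g x) = true})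
  simp only at h4 ⊢
  linarith

/-! ### Nonemptiness and VC dimension zero -/

theorem HasVCDim.nonempty {X : Type*} {H : Set (X → Bool)} {d : ℕ} (hd : HasVCDim H d) :
    H.Nonempty := by
  obtain ⟨S, -, hS⟩ := hd.1
  obtain ⟨h, hh, -⟩ := hS ∅ (Finset.empty_subset S)
  exact ⟨h, hh⟩

theorem HasVCDim.eq_of_zero {X : Type*} {H : Set (X → Bool)} (hd : HasVCDim H 0)
    {h g : X → Bool} (hh : h ∈ H) (hg : g ∈ H) : h = g := by
  by_contra hne
  obtain ⟨x, hx⟩ := Function.ne_iff.1 hne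
  have : Shatters H {x} := by
    intro B hB
    have h1 : ∃ u ∈ H, u x = true := by
      rcases hb : h x with _ | _
      · exact ⟨g, hg, by simp_all⟩
      · exact ⟨h, hh, hb⟩
    have h0 : ∃ u ∈ H, u x = false := by
      rcases hb : h x with _ | _
      · exact ⟨h, hh, hb⟩
      · exact ⟨g, hg, by simp_all⟩
    rcases Finset.subset_singleton_iff.1 hB with rfl | rfl
    · obtain ⟨u, hu, hux⟩ := h0
      exact ⟨u, hu, by simp [hux]⟩
    · obtain ⟨u, hu, hux⟩ := h1
      exact ⟨u, hu, by simp [hux]⟩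
  have := hd.2 ⟨{x}, rfl, this⟩
  simp at this

theorem risk_le_optRisk_of_hasVCDim_zero {X : Type*} [MeasurableSpace X] {k : ℕ}
    (DT : Measure X) (fT : X → ℝ) (DS : Fin k → Measure X) (fS : Fin k → X → ℝ)
    {H : Set (X → Bool)} (hd : HasVCDim H 0) {h : X → Bool} (hh : h ∈ H) :
    risk DT fT h ≤ optRisk H DT fT DS fS := by
  have : Nonempty H := ⟨⟨h, hh⟩⟩
  refine le_ciInf fun ⟨g, hg⟩ => ?_
  rw [hd.eq_of_zero hh hg]
  exact le_add_of_nonneg_right (Real.iSup_nonneg fun i => risk_nonneg _ _ _)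

/-! ### Numerical comparisons -/

/-- For use with `P = log (2 / δ) / m` and `D = d * log (m * e / d) / m`. Since `d ≤ d * log (m * e
/ d)`, the constant `77 / 25` exceeds `1 + 3 * log 2` and `1227 / 1000` lies below `4 - 4 * log 2`.
-/
theorem sqrt_add_sqrt_lt {P D : ℝ} (hP : 0 < P) (hD : 0 ≤ D) :
    √(32 / 49 * (P + 77 / 25 * D)) + √P < √((P + D) / 2) + √(2 * P + 1227 / 1000 * D) := by
  have ha := sq_sqrt (show (0 : ℝ) ≤ 32 / 49 * (P + 77 / 25 * D) by positivity)
  have hb := sq_sqrt hP.le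
  have hr := sq_sqrt (show (0 : ℝ) ≤ (P + D) / 2 by positivity)
  have hs := sq_sqrt (show (0 : ℝ) ≤ 2 * P + 1227 / 1000 * D by positivity)
  have hrs : P + 39 / 50 * D ≤ √((P + D) / 2) * √(2 * P + 1227 / 1000 * D) := by
    rw [← sqrt_mul (by positivity)]
    apply le_sqrt_of_sq_le
    have := mul_nonneg hP.le hD
    nlinarith [sq_nonneg D]
  set a := √(32 / 49 * (P + 77 / 25 * D))
  set b := √P
  set r := √((P + D) / 2)
  set s := √(2 * P + 1227 / 1000 * D)
  -- The weights are close to balanced when `D = 0`, where the ratio `b / a` is `7 / √32`. The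
  -- squares then compare linearly in `P` and `D`.
  have hab : 2 * a * b ≤ 5 / 9 * a ^ 2 + 9 / 5 * b ^ 2 := by
    nlinarith [sq_nonneg (a - 9 / 5 * b)]
  have hr0 : 0 ≤ r := sqrt_nonneg _
  have hs0 : 0 ≤ s := sqrt_nonneg _
  refine lt_of_pow_lt_pow_left₀ 2 (by positivity) ?_
  calc (a + b) ^ 2 = a ^ 2 + 2 * a * b + b ^ 2 := by ring
    _ < r ^ 2 + 2 * (r * s) + s ^ 2 := by rw [hr, hs]; rw [ha, hb] at hab ⊢; linarith
    _ = (r + s) ^ 2 := by ring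

theorem le_mul_log_div {m d : ℕ} (hd : 1 ≤ d) (hdm : d ≤ m) :
    (d : ℝ) ≤ d * log (m * exp 1 / d) := by
  have hd0 : (0 : ℝ) < d := by exact_mod_cast hd
  have hdm' : (d : ℝ) ≤ m := by exact_mod_cast hdm
  refine le_mul_of_one_le_right hd0.le ?_
  rw [le_log_iff_exp_le (by have := hd0.trans_le hdm'; positivity), le_div_iff₀ hd0, mul_comm]
  gcongr

theorem deviations_lt {k m d : ℕ} (hk : 1 ≤ k) (hm : 1 ≤ m) (hd : 1 ≤ d) (hdm : d ≤ m) {δ : ℝ}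
    (hδ : 0 < δ) (hδ1 : δ < 1) :
    √(32 / 49 * (log (2 / δ) + d * log (8 * m * exp 1 / d)) / m) + √(log (2 / δ) / m) <
      √(1 / (2 * m) * (log (4 * k / δ) + d * log (m * exp 1 / d))) +
        √(2 / m * (log (8 * k / δ) + 2 * d * log (m * exp 1 / (2 * d)))) := by
  have hm0 : (0 : ℝ) < m := by exact_mod_cast hm
  have hd0 : (0 : ℝ) < d := by exact_mod_cast hd
  have hk1 : (1 : ℝ) ≤ k := by exact_mod_cast hk
  have hD := le_mul_log_div hd hdm
  set D : ℝ := d * log (m * exp 1 / d) with hDdef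
  set P : ℝ := log (2 / δ) with hPdef
  have hP : 0 < P := log_pos (by rw [lt_div_iff₀ hδ]; linarith)
  have hl1 : log 2 < 0.6931471808 := log_two_lt_d9
  have hl0 : 0 < log 2 := log_pos (by norm_num)
  have h8 : d * log (8 * m * exp 1 / d) = D + 3 * d * log 2 := by
    rw [show 8 * m * exp 1 / d = 2 ^ 3 * (m * exp 1 / d : ℝ) by ring,
      log_mul (by norm_num) (by positivity), log_pow, hDdef]
    push_cast
    ring
  have h2 : 2 * d * log (m * exp 1 / (2 * d)) = 2 * D - 2 * d * log 2 := by
    rw [show m * exp 1 / (2 * d) = (m * exp 1 / d : ℝ) / 2 by field_simp,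
      log_div (by positivity) (by norm_num), hDdef]
    ring
  have hP4 : P ≤ log (4 * k / δ) := log_le_log (by positivity) (by gcongr; linarith)
  have hP8 : P ≤ log (8 * k / δ) := log_le_log (by positivity) (by gcongr; linarith)
  have hdl : d * log 2 ≤ 0.69315 * D := by nlinarith
  calc _ ≤ √(32 / 49 * (P / m + 77 / 25 * (D / m))) + √(P / m) := by
        gcongr
        rw [h8, ← mul_div_assoc, ← add_div, ← mul_div_assoc]
        gcongr ?_ / _
        linarith
    _ < √((P / m + D / m) / 2) + √(2 * (P / m) + 1227 / 1000 * (D / m)) :=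
        sqrt_add_sqrt_lt (by positivity) (div_nonneg (hd0.le.trans hD) hm0.le)
    _ ≤ _ := by
        gcongr
        · rw [← add_div, div_div, div_mul_eq_mul_div, one_mul, mul_comm (2 : ℝ)]
          gcongr
        · rw [h2, ← mul_div_assoc, ← mul_div_assoc, ← add_div, div_mul_eq_mul_div (2 : ℝ) (m : ℝ)]
          gcongr ?_ / _
          linarith

theorem deviations_le {k m d : ℕ} (hk : 1 ≤ k) (hm : 1 ≤ m) (hd : 1 ≤ d) (hdm : d ≤ m) {δ : ℝ}
    (hδ : 0 < δ) (hδ1 : δ < 1) :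
    √(1 / (2 * m) * (log (4 * k / δ) + d * log (m * exp 1 / d))) +
        √(2 / m * (log (8 * k / δ) + 2 * d * log (m * exp 1 / (2 * d)))) ≤
      5 * √((log (k / δ) + d * log (m * exp 1 / d)) / m) := by
  have hm0 : (0 : ℝ) < m := by exact_mod_cast hm
  have hd1 : (1 : ℝ) ≤ d := by exact_mod_cast hd
  have hk1 : (1 : ℝ) ≤ k := by exact_mod_cast hk
  have hD := le_mul_log_div hd hdm
  have hle : (log (m * exp 1 / (2 * d)) : ℝ) ≤ log (m * exp 1 / d) :=
    log_le_log (by positivity) (by gcongr; linarith)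
  have hdle := mul_le_mul_of_nonneg_left hle (show (0 : ℝ) ≤ 2 * d by positivity)
  set D : ℝ := d * log (m * exp 1 / d) with hDdef
  have hL : 0 ≤ log (k / δ) := log_nonneg (by rw [le_div_iff₀ hδ]; linarith)
  have hl1 : log 2 < 0.6931471808 := log_two_lt_d9
  have h4 : log (4 * k / δ) = 2 * log 2 + log (k / δ) := by
    rw [mul_div_assoc, log_mul (by norm_num) (by positivity), show (4 : ℝ) = 2 ^ 2 by norm_num,
      log_pow]
    norm_num
  have h8 : log (8 * k / δ) = 3 * log 2 + log (k / δ) := by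
    rw [mul_div_assoc, log_mul (by norm_num) (by positivity), show (8 : ℝ) = 2 ^ 3 by norm_num,
      log_pow]
    norm_num
  set Q := log (k / δ) + D with hQ
  have hscale : ∀ c : ℝ, 0 ≤ c → √(c ^ 2 * (Q / m)) = c * √(Q / m) := fun c hc => by
    rw [sqrt_mul (sq_nonneg c), sqrt_sq hc]
  have h1 : √(1 / (2 * m) * (log (4 * k / δ) + D)) ≤ 2 * √(Q / m) := by
    rw [← hscale 2 (by norm_num)]
    refine sqrt_le_sqrt ?_
    rw [div_mul_eq_mul_div, one_mul, ← mul_div_assoc, div_le_div_iff₀ (by positivity) hm0, h4]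
    nlinarith
  have h2 : √(2 / m * (log (8 * k / δ) + 2 * d * log (m * exp 1 / (2 * d)))) ≤
      3 * √(Q / m) := by
    rw [← hscale 3 (by norm_num)]
    refine sqrt_le_sqrt ?_
    rw [div_mul_eq_mul_div, ← mul_div_assoc, h8]
    gcongr ?_ / _
    linarith
  linarith

/-! ### Uniform convergence and the good event -/

/-- Uniform convergence of the empirical risks over a class of VC dimension `d ≥ 1`, with a
ghost sample of seven times the size of the sample. -/
theorem measure_exists_risk_gt_le_half {X : Type*} [MeasurableSpace X] {m d : ℕ} (hm : 1 ≤ m)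
    (hd : 1 ≤ d) (hdm : d ≤ m) {μ : Measure X} [IsProbabilityMeasure μ] {f : X → ℝ}
    (hf : Measurable f) (hf01 : ∀ x, f x ∈ Set.Icc (0 : ℝ) 1) {H : Set (X → Bool)}
    (hHm : ∀ h ∈ H, Measurable h) (hH : SampleMeasurable H μ) (hvc : HasVCDim H d) {δ : ℝ}
    (hδ : 0 < δ) (hδ1 : δ < 1) :
    (Measure.pi fun _ : Fin m => μ) {x | ∃ h ∈ H, empRisk x f h +
      √(32 / 49 * (log (2 / δ) + d * log (8 * m * exp 1 / d)) / m) < risk μ f h} ≤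
      ENNReal.ofReal (δ / 2) := by
  have hm0 : (0 : ℝ) < m := by exact_mod_cast hm
  have hd0 : (0 : ℝ) < d := by exact_mod_cast hd
  have : Nonempty (Fin m) := ⟨⟨0, hm⟩⟩
  have hcard : Fintype.card (Fin m ⊕ Fin m × Fin 7) = 8 * m := by simp; ring
  have hS : ∀ z : Fin m ⊕ Fin m × Fin 7 → X,
      ((labelings H z).card : ℝ) ≤ (8 * m * exp 1 / d) ^ d := by
    intro z
    have h := card_labelings_le_pow hvc hd (by rw [hcard]; omega) z
    rw [hcard] at h
    exact_mod_cast h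
  have hE : 0 ≤ log (2 / δ) + d * log (8 * m * exp 1 / d) := by
    have h1 : 0 ≤ log (2 / δ) := log_nonneg (by rw [le_div_iff₀ hδ]; linarith)
    have h2 := le_mul_log_div hd hdm
    have h3 : log (m * exp 1 / d) ≤ log (8 * m * exp 1 / d) :=
      log_le_log (by positivity) (by gcongr; linarith)
    have := mul_le_mul_of_nonneg_left h3 hd0.le
    linarith
  set U := √(32 / 49 * (log (2 / δ) + d * log (8 * m * exp 1 / d)) / m) with hU
  have hU2 : U ^ 2 = 32 / 49 * (log (2 / δ) + d * log (8 * m * exp 1 / d)) / m :=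
    sq_sqrt (by positivity)
  -- This `t` minimizes `t ^ 2 / (8 * m) - t * (7 / 8) * U`; the minimum is `-(49 / 32) * m * U ^
  -- 2`, whence the factor `32 / 49` in `U`.
  have h := measure_exists_risk_gt_le (A := Fin m) (K := Fin 7) hH hHm
    (l := fun b x => |bit b - f x|) (fun b => (hf.const_sub _).abs)
    (fun b x => abs_bit_sub_mem_Icc (hf01 x) b) hS (t := 7 / 2 * m * U)
    (mul_nonneg (by positivity) (sqrt_nonneg _)) U
  simp only [Fintype.card_fin] at h
  refine h.trans (ENNReal.ofReal_le_ofReal (le_of_eq ?_))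
  have hexp : (7 / 2 * m * U) ^ 2 / (8 * m) -
      7 / 2 * m * U * (((7 : ℕ) : ℝ) / ((7 : ℕ) + 1) * U) =
      -log (2 / δ) - d * log (8 * m * exp 1 / d) := by
    have : (7 / 2 * m * U) ^ 2 / (8 * m) -
      7 / 2 * m * U * (((7 : ℕ) : ℝ) / ((7 : ℕ) + 1) * U) = -(49 / 32 * m * U ^ 2) := by
      push_cast
      field_simp
      ring
    rw [this, hU2]
    field_simp
    ring
  rw [hexp, exp_sub, exp_neg, exp_log (by positivity), exp_nat_mul, exp_log (by positivity)]
  field_simp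

/-- Both final inequalities follow from this one: the deviation is exactly the sum of the two square
roots of the first bound, and `deviations_le` converts it for the second. -/
theorem exists_good_event {X : Type*} [MeasurableSpace X] {k m d : ℕ} (hk : 1 ≤ k) (hm : 1 ≤ m)
    (hd : 1 ≤ d) (hdm : d ≤ m) {DT : Measure X} [IsProbabilityMeasure DT] {fT : X → ℝ}
    {DS : Fin k → Measure X} [∀ i, IsProbabilityMeasure (DS i)] {fS : Fin k → X → ℝ}
    (hfT : Measurable fT) (hfT01 : ∀ x, fT x ∈ Set.Icc (0 : ℝ) 1)
    (hfS : ∀ i, Measurable (fS i)) (hfS01 : ∀ i x, fS i x ∈ Set.Icc (0 : ℝ) 1)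
    {H : Set (X → Bool)} (hHm : ∀ h ∈ H, Measurable h)
    (hH : ∀ i, SampleMeasurable H (DS i)) (hvc : HasVCDim H d)
    {δ : ℝ} (hδ : 0 < δ) (hδ1 : δ < 1) :
    ∃ G : Set ((Fin m → X) × (Fin k → Fin m → X)),
      MeasurableSet G ∧ 1 - δ ≤ (sampleLaw m DT DS).real G ∧
      ∀ s ∈ G, ∀ h ∈ H, risk DT fT h ≤ (⨆ i, empRisk (s.2 i) (fS i) h)
        + 1 / 2 * hDivMulti (symmDiffClass H) (empMeasure s.1) (fun i => empMeasure (s.2 i))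
        + optRisk H DT fT DS fS
        + (√(1 / (2 * m) * (log (4 * k / δ) + d * log (m * exp 1 / d)))
          + √(2 / m * (log (8 * k / δ) + 2 * d * log (m * exp 1 / (2 * d))))) := by
  have hm0 : (0 : ℝ) < m := by exact_mod_cast hm
  let i : Fin k := ⟨0, hk⟩
  have hlt := deviations_lt hk hm hd hdm hδ hδ1
  have hunif := measure_exists_risk_gt_le_half hm hd hdm (hfS i) (hfS01 i) hHm (hH i) hvc hδ hδ1
  set U := √(32 / 49 * (log (2 / δ) + d * log (8 * m * exp 1 / d)) / m)
  set τ := √(log (2 / δ) / m) with hτ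
  set R := √(1 / (2 * m) * (log (4 * k / δ) + d * log (m * exp 1 / d)))
          + √(2 / m * (log (8 * k / δ) + 2 * d * log (m * exp 1 / (2 * d))))
  have hne : (symmDiffClass H).Nonempty := by
    obtain ⟨h, hh⟩ := hvc.nonempty
    exact ⟨_, h, hh, h, hh, rfl⟩
  -- `A` depends only on the true distributions and is therefore fixed before sampling; the
  -- tolerance is the slack in `deviations_lt`.
  obtain ⟨A, hA, hAlt⟩ := exists_hDiv_lt hne DT (DS i) (sub_pos.2 hlt)
  have hAm : MeasurableSet A := by
    obtain ⟨_, ⟨h, hh, g, hg, rfl⟩, rfl⟩ := hA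
    exact measurableSet_xor (hHm h hh) (hHm g hg)
  obtain ⟨E, hE, hEle, hEA⟩ := exists_event_abs_sub_le hm DT (DS i) hAm (τ := τ) (sqrt_nonneg _)
  have hEle' : ((Measure.pi fun _ : Fin m => DT).prod (Measure.pi fun _ : Fin m => DS i)).real E ≤
      δ / 2 := by
    refine hEle.trans (le_of_eq ?_)
    rw [hτ, sq_sqrt (div_nonneg (log_nonneg (by rw [le_div_iff₀ hδ]; linarith)) hm0.le),
      mul_div_cancel₀ _ hm0.ne', exp_neg, exp_log (by positivity), inv_div]
  set B := toMeasurable (Measure.pi fun _ : Fin m => DS i)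
    {x | ∃ h ∈ H, empRisk x (fS i) h + U < risk (DS i) (fS i) h} with hB
  have hBle : (Measure.pi fun _ : Fin m => DS i).real B ≤ δ / 2 := by
    rw [measureReal_def, hB, measure_toMeasurable]
    exact ENNReal.toReal_le_of_le_ofReal (by positivity) hunif
  have hmpi : MeasurePreserving (fun y : Fin k → Fin m → X => y i)
      (Measure.pi fun i => Measure.pi fun _ => DS i) (Measure.pi fun _ => DS i) :=
    measurePreserving_eval (fun i => Measure.pi fun _ : Fin m => DS i) i
  have hmp1 : MeasurePreserving
      (fun s : (Fin m → X) × (Fin k → Fin m → X) => s.2 i) (sampleLaw m DT DS)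
      (Measure.pi fun _ => DS i) := hmpi.comp measurePreserving_snd
  have hmp2 : MeasurePreserving
      (fun s : (Fin m → X) × (Fin k → Fin m → X) => (s.1, s.2 i)) (sampleLaw m DT DS)
      ((Measure.pi fun _ => DT).prod (Measure.pi fun _ => DS i)) :=
    (MeasurePreserving.id _).prod hmpi
  have hBm : MeasurableSet B := measurableSet_toMeasurable _ _
  set N := (fun s : (Fin m → X) × (Fin k → Fin m → X) => s.2 i) ⁻¹' B ∪
    (fun s : (Fin m → X) × (Fin k → Fin m → X) => (s.1, s.2 i)) ⁻¹' E with hN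
  have hNm : MeasurableSet N := (hmp1.measurable hBm).union (hmp2.measurable hE)
  have hprob : IsProbabilityMeasure (sampleLaw m DT DS) := by unfold sampleLaw; infer_instance
  refine ⟨Nᶜ, hNm.compl, ?_, fun s hs h hh => ?_⟩
  · rw [probReal_compl_eq_one_sub hNm]
    have h1 := measureReal_union_le (μ := sampleLaw m DT DS)
      ((fun s : (Fin m → X) × (Fin k → Fin m → X) => s.2 i) ⁻¹' B)
      ((fun s : (Fin m → X) × (Fin k → Fin m → X) => (s.1, s.2 i)) ⁻¹' E)
    rw [hmp1.measureReal_preimage hBm.nullMeasurableSet,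
      hmp2.measureReal_preimage hE.nullMeasurableSet] at h1
    linarith
  · have hsB : s.2 i ∉ B := fun hb => hs (Or.inl hb)
    have hsE : (s.1, s.2 i) ∉ E := fun he => hs (Or.inr he)
    have h1 : risk (DS i) (fS i) h ≤ empRisk (s.2 i) (fS i) h + U := by
      by_contra hcon
      exact hsB (subset_toMeasurable _ _ ⟨h, hh, not_le.1 hcon⟩)
    have h2 := hEA _ hsE
    have := isProbabilityMeasure_empMeasure hm s.1
    have := isProbabilityMeasure_empMeasure hm (s.2 i)
    have h3 := abs_measureReal_sub_le_hDiv (empMeasure s.1) (empMeasure (s.2 i)) hA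
    have h4 : hDiv (symmDiffClass H) (empMeasure s.1) (empMeasure (s.2 i)) ≤
        hDivMulti (symmDiffClass H) (empMeasure s.1) (fun i => empMeasure (s.2 i)) :=
      le_ciSup (f := fun i => hDiv (symmDiffClass H) (empMeasure s.1) (empMeasure (s.2 i)))
        (Set.finite_range _).bddAbove i
    have h5 : empRisk (s.2 i) (fS i) h ≤ ⨆ i, empRisk (s.2 i) (fS i) h :=
      le_ciSup (f := fun i => empRisk (s.2 i) (fS i) h) (Set.finite_range _).bddAbove i
    have h6 := risk_le_add_hDiv_add_optRisk (DT := DT) (DS := DS) hfT hfT01 hfS hfS01 hHm i hh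
    simp only at h2
    linarith

end MSDA

theorem mainTheorem1 :
    ∃ C : ℝ, 0 < C ∧
      ∀ (X : Type*) [MeasurableSpace X] (k m d : ℕ) (_ : 1 ≤ k) (_ : 1 ≤ m) (_ : d ≤ m)
        (DT : Measure X) [IsProbabilityMeasure DT] (fT : X → ℝ)
        (DS : Fin k → Measure X) [∀ i, IsProbabilityMeasure (DS i)] (fS : Fin k → X → ℝ)
        (_ : Measurable fT) (_ : ∀ x, fT x ∈ Set.Icc (0 : ℝ) 1)
        (_ : ∀ i, Measurable (fS i)) (_ : ∀ i x, fS i x ∈ Set.Icc (0 : ℝ) 1)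
        (H : Set (X → Bool)) (_ : ∀ h ∈ H, Measurable h)
        (_ : ∀ i, MSDA.SampleMeasurable H (DS i))
        (_ : MSDA.HasVCDim H d)
        (δ : ℝ) (_ : 0 < δ) (_ : δ < 1),
        ∃ G : Set ((Fin m → X) × (Fin k → Fin m → X)),
          MeasurableSet G ∧ 1 - δ ≤ (MSDA.sampleLaw m DT DS).real G ∧
          ∀ s ∈ G, ∀ h ∈ H,
            (MSDA.risk DT fT h ≤
              (⨆ i, MSDA.empRisk (s.2 i) (fS i) h)
              + √(1 / (2 * m) * (log (4 * k / δ) + d * log (m * exp 1 / d)))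
              + 1 / 2 * MSDA.hDivMulti (MSDA.symmDiffClass H)
                  (MSDA.empMeasure s.1) (fun i => MSDA.empMeasure (s.2 i))
              + √(2 / m * (log (8 * k / δ) + 2 * d * log (m * exp 1 / (2 * d))))
              + MSDA.optRisk H DT fT DS fS) ∧
            (MSDA.risk DT fT h ≤
              (⨆ i, MSDA.empRisk (s.2 i) (fS i) h)
              + 1 / 2 * MSDA.hDivMulti (MSDA.symmDiffClass H)
                  (MSDA.empMeasure s.1) (fun i => MSDA.empMeasure (s.2 i))
              + MSDA.optRisk H DT fT DS fS
              + C * √((log (k / δ) + d * log (m * exp 1 / d)) / m)) := by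

  -- In `deviations_le` the two square roots cost at most 2 and 3 times the common one.
  refine ⟨5, by norm_num, ?_⟩
  intro X _ k m d hk hm hdm DT _ fT DS _ fS hfT hfT01 hfS hfS01 H hHm hH hvc δ hδ hδ1
  -- When `d = 0`, all hypotheses of `H` coincide, so `optRisk` alone already dominates the target
  -- risk on every sample.
  rcases Nat.eq_zero_or_pos d with rfl | hd
  · refine ⟨Set.univ, MeasurableSet.univ, ?_, fun s _ h hh => ?_⟩
    · have : IsProbabilityMeasure (MSDA.sampleLaw m DT DS) := by
        unfold MSDA.sampleLaw; infer_instance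
      rw [probReal_univ (μ := MSDA.sampleLaw m DT DS)]
      linarith
    · have h1 := MSDA.risk_le_optRisk_of_hasVCDim_zero DT fT DS fS hvc hh
      have h2 : 0 ≤ ⨆ i, MSDA.empRisk (s.2 i) (fS i) h :=
        Real.iSup_nonneg fun i => MSDA.empRisk_nonneg _ _ _
      have h3 := MSDA.hDivMulti_nonneg (MSDA.symmDiffClass H) (MSDA.empMeasure s.1)
        (fun i => MSDA.empMeasure (s.2 i))
      constructor <;> refine h1.trans ?_
      · exact le_add_of_nonneg_left (by positivity)
      · rw [add_right_comm]
        exact le_add_of_nonneg_left (by positivity)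
  · obtain ⟨G, hG, hGle, hGbound⟩ :=
      MSDA.exists_good_event (DT := DT) (DS := DS) hk hm hd hdm hfT hfT01 hfS hfS01 hHm hH hvc
        hδ hδ1
    refine ⟨G, hG, hGle, fun s hs h hh => ?_⟩
    have h1 := hGbound s hs h hh
    have h2 := MSDA.deviations_le hk hm hd hdm hδ hδ1
    constructor <;> linarith
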